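/- **Theorem (Theorems 4.4 and 4.5).** *Setting.* Let $(X,d)$ be a compact metric space and let $f_n:X\to X$, $n\ge 0$, be continuous maps such that $\{f_n\}_{n\ge0}$ is equi-continuous in $X$: for every $\epsilon>0$ there is $\delta>0$ such that $d(f_n(x),f_n(y))<\epsilon$ for all $n\ge 0$ and all $x,y\in X$ with $d(x,y)<\delta$. Write $f_i^0=\mathrm{id}$ and $f_i^k=f_{i+k-1}\circ\cdots\circ f_i$ for $k\ge1$. Let $N\ge2$ and let $A=(a_{ij})_{N\times N}$ be a transition matrix, that is, $a_{ij}\in\{0,1\}$, $\sum_j a_{ij}\ge1$ for all $i$, and $\sum_i a_{ij}\ge1$ for all $j$. Let $\Sigma_N^+(A)$ be the set of sequences $(s_0,s_1,\dots)$ in $\{1,\dots,N\}$ with $a_{s_js_{j+1}}=1$ for all $j\ge0$, with the metric $\hat\rho(\alpha,\beta)=\sum_{i\ge0}\hat d(a_i,b_i)2^{-i}$ for $\alpha=(a_0,a_1,\dots)$ and $\beta=(b_0,b_1,\dots)$, where $\hat d(a,b)=0$ if $a=b$ and $1$ otherwise. Let $\sigma_A(s_0,s_1,\dots)=(s_1,s_2,\dots)$,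 and let $\rho(A)=\lim_{n\to\infty}\|A^n\|^{1/n}$, where $\|A\|=\sum_{i,j}a_{ij}$. Let $V_1,\dots,V_N$ be pairwise disjoint closed subsets of $X$, and for $1\le i\le N$, $n\ge0$ let $V_{i,n}\subset V_i$ be a nonempty closed subset. Put $V_\alpha^{m,n}=\bigcap_{k=0}^m (f_n^{k})^{-1}(V_{a_k,n+k})$ for $\alpha=(a_0,a_1,\dots)\in\Sigma_N^+(A)$. Let $\mathcal K(X)$ be the space of nonempty compact subsets of $X$ with the Hausdorff metric, $\bar f_n:\mathcal K(X)\to\mathcal K(X)$, $\bar f_n(K)=f_n(K)$, and $\langle K\rangle=\{B\in\mathcal K(X):B\subset K\}$. For nonempty $Y\subset\mathcal K(X)$ let $h(\bar f_{0,\infty},Y)=\sup_{\mathcal A}\limsup_{n\to\infty}\frac1n\log\mathcal N(\mathcal A_0^n|_Y)$, the supremum being over the open covers $\mathcal A$ of $\mathcal K(X)$, where $\mathcal A_0^n=\{\bigcap_{j=0}^{n-1}(\bar f_0^{j})^{-1}(A_j):A_j\in\mathcal A\}$, $\mathcal{A}_0^n|_Y=\{B\cap Y: B\in\mathcal{A}_0^n\}$,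 and $\mathcal N$ is the minimal cardinality of a subcover of $Y$. *(a)* Assume $\mathbf{(H_1)}$: $V_\alpha^{m,n}\ne\emptyset$ for all $m,n\ge0$ and all $\alpha\in\Sigma_N^+(A)$. Then there are nonempty compact sets $\mathcal C_n\subset\bigcup_{i=1}^N\langle V_{i,n}\rangle$, $n\ge0$, with $\bar f_n(\mathcal C_n)\subset\mathcal C_{n+1}$ for all $n\ge0$, such that the subsystem of $\{\bar f_n\}$ on $\{\mathcal C_n\}$ is topologically equi-semiconjugate to $(\Sigma_N^+(A),\sigma_A)$; that is, there are surjections $h_n:\mathcal C_n\to\Sigma_N^+(A)$, equi-continuous in the sense that for every $\epsilon>0$ one $\delta>0$ serves all $n\ge0$ and all pairs of points of $\mathcal C_n$, with $h_{n+1}\circ\bar f_n=\sigma_A\circ h_n$ on $\mathcal C_n$ for all $n\ge0$. Moreover $h(\bar f_{0,\infty},\mathcal C_0)\ge\log\rho(A)$. *(b)* Instead of $\mathbf{(H_1)}$, assume that $\{f_n\}$ is weakly $A$-coupled-expanding in $\{V_{i,n}\}$: $V_{i,n}\cap V_{j,n}=\partial V_{i,n}\cap\partial V_{j,n}$ for all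 $i\ne j$ and $n\ge0$, and $f_n(V_{i,n})\supset\bigcup_{a_{ij}=1}V_{j,n+1}$ for all $i$ and $n\ge0$. Then there are sets $\mathcal C_n$ with all the properties in (a) and, in addition, $\bar f_n(\mathcal C_n)=\mathcal C_{n+1}$ for all $n\ge0$. -/

import Mathlib

open Set Filter Topology TopologicalSpace

noncomputable section

namespace SetValuedSubshift

/-! ### Non-autonomous discrete systems `x_{n+1} = f_n (x_n)` -/

/-- `iter f i n` is `f_i^n = f_{i+n-1} ∘ ⋯ ∘ f_i`, with `f_i^0 = id`. -/
def iter {X : Type*} (f : ℕ → X → X) (i : ℕ) : ℕ → X → X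
  | 0 => id
  | n + 1 => f (i + n) ∘ iter f i n

/-- Equi-continuity of a sequence of maps `h_n : α_n → β_n` between metric spaces:
one `δ` serves all `n` and all pairs of points. -/
def EquiContinuousSeq {α β : ℕ → Type*} [∀ n, PseudoMetricSpace (α n)]
    [∀ n, PseudoMetricSpace (β n)] (h : ∀ n, α n → β n) : Prop :=
  ∀ ε : ℝ, 0 < ε → ∃ δ : ℝ, 0 < δ ∧
    ∀ (n : ℕ) (x y : α n), dist x y < δ → dist (h n x) (h n y) < ε

/-- The sequence `Λ` of subsets is invariant: `f_n (Λ_n) ⊆ Λ_{n+1}` for all `n`. -/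
def IsInvariantSeq {X : Type*} (f : ℕ → X → X) (Λ : ℕ → Set X) : Prop :=
  ∀ n, MapsTo (f n) (Λ n) (Λ (n + 1))

/-- The invariant subsystem of `f` on `Λ` is topologically equi-semiconjugate to the invariant
subsystem of `g` on `E`: both sequences of sets are invariant, and there is an equi-continuous
sequence of surjections `h_n : Λ_n → E_n` with `h_{n+1} ∘ f_n = g_n ∘ h_n`. -/
def IsEquiSemiconjugate {X Y : Type*} [PseudoMetricSpace X] [PseudoMetricSpace Y]
    (f : ℕ → X → X) (Λ : ℕ → Set X) (g : ℕ → Y → Y) (E : ℕ → Set Y) : Prop :=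
  ∃ (hΛ : IsInvariantSeq f Λ) (hE : IsInvariantSeq g E) (h : ∀ n, ↥(Λ n) → ↥(E n)),
    EquiContinuousSeq h ∧ (∀ n, Function.Surjective (h n)) ∧
      ∀ n, h (n + 1) ∘ (hΛ n).restrict (f n) (Λ n) (Λ (n + 1))
        = (hE n).restrict (g n) (E n) (E (n + 1)) ∘ h n

/-! ### Topological entropy through open covers -/

/-- The family `𝒜_0^n = {⋂_{j<n} f_0^{-j}(A_j) : A_j ∈ 𝒜}`. -/
def joinCover {X : Type*} (f : ℕ → X → X) (𝒜 : Set (Set X)) (n : ℕ) : Set (Set X) :=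
  {S | ∃ U : Fin n → Set X, (∀ j, U j ∈ 𝒜) ∧ S = ⋂ j : Fin n, iter f 0 j ⁻¹' U j}

/-- The family `{C ∩ Y : C ∈ 𝒞}`. -/
def restrictCover {X : Type*} (𝒞 : Set (Set X)) (Y : Set X) : Set (Set X) :=
  (fun C => C ∩ Y) '' 𝒞

/-- The least cardinality of a subfamily of `𝒞` that still covers `Y`. -/
def minSubcover {X : Type*} (𝒞 : Set (Set X)) (Y : Set X) : ℕ∞ :=
  ⨅ (ℬ : Set (Set X)) (_ : ℬ ⊆ 𝒞) (_ : Y ⊆ ⋃₀ ℬ), ℬ.encard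

/-- The topological entropy `h(f_{0,∞}, Y)` of a non-autonomous system on a subset `Y`: the
supremum over all open covers `𝒜` of the space of
`limsup_{n → ∞} log 𝒩(𝒜_0^n |_Y) / n`, as an extended real number. -/
def entropy {X : Type*} [TopologicalSpace X] (f : ℕ → X → X) (Y : Set X) : EReal :=
  ⨆ (𝒜 : Set (Set X)) (_ : ∀ U ∈ 𝒜, IsOpen U) (_ : ⋃₀ 𝒜 = univ),
    limsup (fun n : ℕ =>
      ENNReal.log ((minSubcover (restrictCover (joinCover f 𝒜 n) Y) Y : ℕ∞) : ENNReal)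
        / ((n : ℕ) : EReal)) atTop

/-! ### The induced set-valued system on the nonempty compact subsets -/

/-- The induced map `f̄_n (K) = f_n (K)` on `𝒦(X)`. Mathlib's `NonemptyCompacts X` carries the
Hausdorff metric. -/
def induced {X : Type*} [TopologicalSpace X] (f : ℕ → X → X) (hf : ∀ n, Continuous (f n)) :
    ℕ → NonemptyCompacts X → NonemptyCompacts X :=
  fun n K => K.map (f n) (hf n)

/-- `⟨K⟩ = {A ∈ 𝒦(X) : A ⊆ K}`. -/
def compactsIn {X : Type*} [TopologicalSpace X] (K : Set X) : Set (NonemptyCompacts X) :=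
  {A | (A : Set X) ⊆ K}

/-! ### Transition matrices and subshifts of finite type -/

/-- Transition matrices: size at least two, entries `0` or `1`, no zero row, no zero column. -/
structure IsTransitionMatrix {N : ℕ} (A : Matrix (Fin N) (Fin N) ℝ) : Prop where
  two_le : 2 ≤ N
  zero_or_one : ∀ i j, A i j = 0 ∨ A i j = 1
  one_le_row : ∀ i, 1 ≤ ∑ j, A i j
  one_le_col : ∀ j, 1 ≤ ∑ i, A i j

/-- `‖A‖ = ∑_{i,j} a_{ij}`. -/
def entrySum {N : ℕ} (A : Matrix (Fin N) (Fin N) ℝ) : ℝ := ∑ i, ∑ j, A i j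

/-- `ρ(A) = lim_{n → ∞} ‖A^n‖^{1/n}`. For a transition matrix this limit exists, see
`tendsto_rho`. -/
def rho {N : ℕ} (A : Matrix (Fin N) (Fin N) ℝ) : ℝ :=
  limUnder atTop (fun n : ℕ => entrySum (A ^ n) ^ ((1 : ℝ) / (n : ℝ)))

/-- The space `Σ_N^+(A)` of one-sided sequences of symbols all of whose transitions are allowed
by `A`. -/
def Shift {N : ℕ} (A : Matrix (Fin N) (Fin N) ℝ) : Type :=
  {s : ℕ → Fin N // ∀ j, A (s j) (s (j + 1)) = 1}

/-- The term `d̂(a_i, b_i) / 2^i` of the metric of the shift space. -/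
def shiftTerm {N : ℕ} (s t : ℕ → Fin N) (i : ℕ) : ℝ :=
  (if s i = t i then (0 : ℝ) else 1) / 2 ^ i

theorem shiftTerm_nonneg {N : ℕ} (s t : ℕ → Fin N) (i : ℕ) : 0 ≤ shiftTerm s t i := by
  unfold shiftTerm; split_ifs <;> positivity

theorem summable_shiftTerm {N : ℕ} (s t : ℕ → Fin N) : Summable (shiftTerm s t) := by
  refine Summable.of_nonneg_of_le (shiftTerm_nonneg s t) (fun i => ?_) summable_geometric_two
  unfold shiftTerm
  split_ifs
  · simp
  · simp

theorem shiftTerm_triangle {N : ℕ} (s t u : ℕ → Fin N) (i : ℕ) :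
    shiftTerm s u i ≤ shiftTerm s t i + shiftTerm t u i := by
  unfold shiftTerm
  rw [← add_div]
  gcongr
  by_cases h1 : s i = t i
  · simp [h1]
  · simp only [h1, if_false]
    split_ifs <;> norm_num

/-- The metric `ρ̂(α, β) = ∑_i d̂(a_i, b_i) / 2^i`. -/
instance {N : ℕ} (A : Matrix (Fin N) (Fin N) ℝ) : MetricSpace (Shift A) where
  dist α β := ∑' i, shiftTerm α.1 β.1 i
  dist_self α := by simp [shiftTerm]
  dist_comm α β := by simp only [shiftTerm, eq_comm]
  dist_triangle α β γ := by
    rw [← (summable_shiftTerm α.1 β.1).tsum_add (summable_shiftTerm β.1 γ.1)]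
    exact (summable_shiftTerm α.1 γ.1).tsum_le_tsum (shiftTerm_triangle α.1 β.1 γ.1)
      ((summable_shiftTerm α.1 β.1).add (summable_shiftTerm β.1 γ.1))
  eq_of_dist_eq_zero {α β} h := by
    have h0 := ((summable_shiftTerm α.1 β.1).hasSum_iff.mpr h)
    rw [hasSum_zero_iff_of_nonneg (shiftTerm_nonneg α.1 β.1)] at h0
    apply Subtype.ext
    funext i
    have hi := congrFun h0 i
    by_contra hne
    simp [shiftTerm, hne] at hi

/-- The shift map `σ_A (s_0, s_1, s_2, …) = (s_1, s_2, …)`. -/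
def shiftMap {N : ℕ} (A : Matrix (Fin N) (Fin N) ℝ) : Shift A → Shift A :=
  fun s => ⟨fun j => s.1 (j + 1), fun j => s.2 (j + 1)⟩

/-! ### Cylinders and weak coupled-expansion -/

/-- `V_α^{m,n} = ⋂_{k=0}^m f_n^{-k}(V_{a_k, n+k})`. -/
def cylinder {X : Type*} {N : ℕ} {A : Matrix (Fin N) (Fin N) ℝ} (f : ℕ → X → X)
    (V : Fin N → ℕ → Set X) (α : Shift A) (m n : ℕ) : Set X :=
  ⋂ k ∈ Finset.range (m + 1), iter f n k ⁻¹' V (α.1 k) (n + k)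

/-- `f` is weakly `A`-coupled-expanding in `{V_{i,n}}`, for a transition matrix `A`. -/
structure IsWeaklyCoupledExpanding {X : Type*} [TopologicalSpace X] {N : ℕ}
    (A : Matrix (Fin N) (Fin N) ℝ) (f : ℕ → X → X) (V : Fin N → ℕ → Set X) : Prop where
  transition : IsTransitionMatrix A
  nonempty : ∀ i n, (V i n).Nonempty
  inter_eq : ∀ i j n, i ≠ j → V i n ∩ V j n = frontier (V i n) ∩ frontier (V j n)
  expanding : ∀ i n, (⋃ (j : Fin N) (_ : A i j = 1), V j (n + 1)) ⊆ f n '' V i n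

/-! ### The limit defining `ρ(A)` exists -/

theorem pow_nonneg_entries {N : ℕ} {A : Matrix (Fin N) (Fin N) ℝ} (h : ∀ i j, 0 ≤ A i j) (n : ℕ) :
    ∀ i j, 0 ≤ (A ^ n) i j := by
  induction n with
  | zero =>
    intro i j
    rw [pow_zero, Matrix.one_apply]
    split_ifs
    · exact zero_le_one
    · exact le_rfl
  | succ n ih =>
    intro i j
    rw [pow_succ, Matrix.mul_apply]
    exact Finset.sum_nonneg fun k _ => mul_nonneg (ih i k) (h k j)

theorem entrySum_mul_le {N : ℕ} {A B : Matrix (Fin N) (Fin N) ℝ} (hA : ∀ i j, 0 ≤ A i j)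
    (hB : ∀ i j, 0 ≤ B i j) : entrySum (A * B) ≤ entrySum A * entrySum B := by
  have hrow : ∀ k, ∑ j, B k j ≤ entrySum B := fun k =>
    Finset.single_le_sum (f := fun k => ∑ j, B k j)
      (fun i _ => Finset.sum_nonneg fun j _ => hB i j) (Finset.mem_univ k)
  have : entrySum (A * B) = ∑ i, ∑ k, A i k * ∑ j, B k j := by
    unfold entrySum
    refine Finset.sum_congr rfl fun i _ => ?_
    simp only [Matrix.mul_apply, Finset.mul_sum]
    exact Finset.sum_comm
  rw [this]
  conv_rhs => rw [entrySum, Finset.sum_mul]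
  refine Finset.sum_le_sum fun i _ => ?_
  rw [Finset.sum_mul]
  exact Finset.sum_le_sum fun k _ => mul_le_mul_of_nonneg_left (hrow k) (hA i k)

theorem IsTransitionMatrix.nonneg {N : ℕ} {A : Matrix (Fin N) (Fin N) ℝ}
    (hA : IsTransitionMatrix A) (i j : Fin N) : 0 ≤ A i j := by
  rcases hA.zero_or_one i j with h | h <;> rw [h] <;> norm_num

theorem IsTransitionMatrix.one_le_entrySum_pow {N : ℕ} {A : Matrix (Fin N) (Fin N) ℝ}
    (hA : IsTransitionMatrix A) (n : ℕ) : 1 ≤ entrySum (A ^ n) := by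
  have hrow : ∀ n i, 1 ≤ ∑ j, (A ^ n) i j := by
    intro n
    induction n with
    | zero => intro i; simp [Matrix.one_apply]
    | succ n ih =>
      intro i
      have : ∑ j, (A ^ (n + 1)) i j = ∑ k, (A ^ n) i k * ∑ j, A k j := by
        simp only [pow_succ, Matrix.mul_apply, Finset.mul_sum]
        exact Finset.sum_comm
      rw [this]
      refine (ih i).trans (Finset.sum_le_sum fun k _ => ?_)
      exact le_mul_of_one_le_right (pow_nonneg_entries hA.nonneg n i k) (hA.one_le_row k)
  have hN := hA.two_le
  exact (hrow n ⟨0, by omega⟩).trans (Finset.single_le_sum (f := fun i => ∑ j, (A ^ n) i j)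
    (fun i _ => Finset.sum_nonneg fun j _ => pow_nonneg_entries hA.nonneg n i j)
    (Finset.mem_univ _))

theorem tendsto_rho {N : ℕ} {A : Matrix (Fin N) (Fin N) ℝ} (hA : IsTransitionMatrix A) :
    Tendsto (fun n : ℕ => entrySum (A ^ n) ^ ((1 : ℝ) / (n : ℝ))) atTop (𝓝 (rho A)) := by
  have hpos : ∀ n, 0 < entrySum (A ^ n) := fun n =>
    lt_of_lt_of_le one_pos (hA.one_le_entrySum_pow n)
  have hsub : Subadditive fun n => Real.log (entrySum (A ^ n)) := by
    intro m n
    rw [← Real.log_mul (hpos m).ne' (hpos n).ne']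
    change Real.log (entrySum (A ^ (m + n))) ≤ _
    rw [pow_add]
    refine Real.log_le_log (by rw [← pow_add]; exact hpos _) ?_
    exact entrySum_mul_le (pow_nonneg_entries hA.nonneg m) (pow_nonneg_entries hA.nonneg n)
  have hb : BddBelow (range fun n : ℕ => Real.log (entrySum (A ^ n)) / (n : ℝ)) := by
    refine ⟨0, ?_⟩
    rintro _ ⟨n, rfl⟩
    exact div_nonneg (Real.log_nonneg (hA.one_le_entrySum_pow n)) (Nat.cast_nonneg n)
  have hlim := (Real.continuous_exp.tendsto _).comp (hsub.tendsto_lim hb)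
  refine tendsto_nhds_limUnder ⟨_, hlim.congr fun n => ?_⟩
  simp only [Function.comp]
  rw [Real.rpow_def_of_pos (hpos n), mul_one_div]

end SetValuedSubshift

end

noncomputable section

namespace SetValuedSubshift

/-! ### Iterates -/

/-! Take `C n` to be the set of compact `B` all of whose points follow one common `α` in the
subshift from time `n` on (`itinerarySet`). The `W i` are disjoint, so `α` is determined by `B`; the
semiconjugacy sends `B` to `α`. It is onto because each `α` is followed by the intersection of its
nested compact cylinders (`exists_mem_follows`).

Everything metric rests on one gap `η > 0` between the `W i`. By equi-continuity, Hausdorff-close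
sets keep points `η`-close for `m` steps, uniformly in the starting time, hence share `m` symbols.
For the entropy, a cover of `𝒦(X)` by balls of radius `η / 2` separates symbols, so sets following
different words of `n + 1` letters need different members of the `(n + 1)`-fold join; there are
`entrySum (A ^ n)` such words (`card_allWords_le_minSubcover`).

Weak coupled-expansion makes all cylinders nonempty by successive preimages, and it lifts each `B`
in `C (n + 1)` to a set in `C n` (`image_itinerarySet`). -/

theorem iter_succ_apply {X : Type*} (f : ℕ → X → X) (i n : ℕ) (x : X) :
    iter f i (n + 1) x = f (i + n) (iter f i n x) := rfl

theorem iter_succ_apply' {X : Type*} (f : ℕ → X → X) (i n : ℕ) (x : X) :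
    iter f i (n + 1) x = iter f (i + 1) n (f i x) := by
  induction n with
  | zero => rfl
  | succ n ih =>
    rw [iter_succ_apply, ih, iter_succ_apply, show i + (n + 1) = i + 1 + n by omega]

theorem continuous_iter {X : Type*} [TopologicalSpace X] {f : ℕ → X → X}
    (hf : ∀ n, Continuous (f n)) (i n : ℕ) : Continuous (iter f i n) := by
  induction n with
  | zero => exact continuous_id
  | succ n ih => exact (hf _).comp ih

/-- Peeling off the first map, not the last, moves the start from `n` to `n + 1`; this is harmless
because the inductive `δ` serves every start. -/
theorem EquiContinuousSeq.exists_iter {X : Type*} [PseudoMetricSpace X] {f : ℕ → X → X}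
    (hf : EquiContinuousSeq (α := fun _ => X) (β := fun _ => X) f) (m : ℕ) {ε : ℝ} (hε : 0 < ε) :
    ∃ δ : ℝ, 0 < δ ∧ ∀ (n : ℕ) (x y : X), dist x y < δ →
      ∀ k ≤ m, dist (iter f n k x) (iter f n k y) < ε := by
  induction m with
  | zero =>
    refine ⟨ε, hε, fun n x y h k hk => ?_⟩
    obtain rfl : k = 0 := by omega
    exact h
  | succ m ih =>
    obtain ⟨δ, hδ, H⟩ := ih
    obtain ⟨δ', hδ', H'⟩ := hf δ hδ
    refine ⟨min ε δ', lt_min hε hδ', fun n x y h k hk => ?_⟩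
    cases k with
    | zero => exact h.trans_le (min_le_left _ _)
    | succ k =>
      rw [iter_succ_apply', iter_succ_apply']
      exact H (n + 1) _ _ (H' n x y (h.trans_le (min_le_right _ _))) k (by omega)

theorem coe_iter_induced {X : Type*} [TopologicalSpace X] {f : ℕ → X → X}
    (hf : ∀ n, Continuous (f n)) (i n : ℕ) (B : NonemptyCompacts X) :
    ((iter (induced f hf) i n B : NonemptyCompacts X) : Set X) = iter f i n '' B := by
  induction n with
  | zero => exact (image_id _).symm
  | succ n ih =>
    rw [iter_succ_apply]
    change f (i + n) '' (iter (induced f hf) i n B : NonemptyCompacts X) = _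
    rw [ih, image_image]
    rfl

/-! ### Compact sets in a metric space -/

/-- Each pair of disjoint compact sets has a positive gap, and every smaller `η` also works, so
finitely many pairs can be treated at once as `η → 0+`. -/
theorem exists_pos_forall_le_dist {X ι : Type*} [MetricSpace X] [CompactSpace X] [Finite ι]
    {W : ι → Set X} (hW : ∀ i, IsClosed (W i)) (hd : ∀ i j, i ≠ j → Disjoint (W i) (W j)) :
    ∃ η : ℝ, 0 < η ∧ ∀ i j, ∀ x ∈ W i, ∀ y ∈ W j, dist x y < η → i = j := by
  have key : ∀ p : ι × ι, ∀ᶠ η in 𝓝[>] (0 : ℝ),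
      ∀ x ∈ W p.1, ∀ y ∈ W p.2, dist x y < η → p.1 = p.2 := by
    rintro ⟨i, j⟩
    by_cases hij : i = j
    · exact Eventually.of_forall fun _ _ _ _ _ _ => hij
    · obtain ⟨δ, hδ, H⟩ := (hd i j hij).exists_thickenings (hW i).isCompact (hW j)
      filter_upwards [Ioo_mem_nhdsGT hδ] with η hη x hx y hy hxy
      refine absurd (Metric.self_subset_thickening hδ _ hy) (Set.disjoint_left.1 H ?_)
      exact Metric.mem_thickening_iff.2 ⟨x, hx, by rw [dist_comm]; exact hxy.trans hη.2⟩
  obtain ⟨η, h1, h2⟩ := ((eventually_all.2 key).and self_mem_nhdsWithin).exists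
  exact ⟨η, h2, fun i j => h1 (i, j)⟩

theorem exists_dist_lt_of_mem {X : Type*} [MetricSpace X] {B B' : NonemptyCompacts X} {r : ℝ}
    (h : dist B B' < r) {x : X} (hx : x ∈ B) : ∃ y ∈ B', dist x y < r := by
  rw [Metric.NonemptyCompacts.dist_eq] at h
  exact Metric.exists_dist_lt_of_hausdorffDist_lt hx h
    (Metric.hausdorffEDist_ne_top_of_nonempty_of_bounded B.nonempty B'.nonempty
      B.isCompact.isBounded B'.isCompact.isBounded)

/-! ### Points of the subshift -/

section Shift

variable {N : ℕ} {A : Matrix (Fin N) (Fin N) ℝ}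

theorem Shift.dist_def (α β : Shift A) : dist α β = ∑' i, shiftTerm α.1 β.1 i := rfl

theorem Shift.dist_le_of_agree {α β : Shift A} {m : ℕ} (h : ∀ k < m, α.1 k = β.1 k) :
    dist α β ≤ 2 * (1 / 2) ^ m := by
  have h0 : ∑ k ∈ Finset.range m, shiftTerm α.1 β.1 k = 0 :=
    Finset.sum_eq_zero fun k hk => by simp [shiftTerm, h k (Finset.mem_range.1 hk)]
  have hs := summable_shiftTerm α.1 β.1
  rw [Shift.dist_def, ← hs.sum_add_tsum_nat_add m, h0, zero_add]
  have hg : HasSum (fun k : ℕ => (1 / 2 : ℝ) ^ m * (1 / 2) ^ k) ((1 / 2) ^ m * 2) :=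
    hasSum_geometric_two.mul_left _
  rw [mul_comm, ← hg.tsum_eq]
  refine ((summable_nat_add_iff m).2 hs).tsum_le_tsum (fun k => ?_) hg.summable
  rw [← pow_add, add_comm m k, one_div_pow]
  unfold shiftTerm
  split_ifs <;> simp

/-- The sequence `(i, s_0, s_1, …)`. -/
def Shift.cons (i : Fin N) (s : Shift A) (h : A i (s.1 0) = 1) : Shift A :=
  ⟨fun k => k.casesOn i s.1, fun k => by
    cases k with
    | zero => exact h
    | succ k => exact s.2 k⟩

theorem IsTransitionMatrix.exists_row (hA : IsTransitionMatrix A) (i : Fin N) :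
    ∃ j, A i j = 1 := by
  by_contra! h
  have := hA.one_le_row i
  rw [Finset.sum_eq_zero fun j _ => (hA.zero_or_one i j).resolve_right (h j)] at this
  norm_num at this

theorem IsTransitionMatrix.exists_col (hA : IsTransitionMatrix A) (j : Fin N) :
    ∃ i, A i j = 1 := by
  by_contra! h
  have := hA.one_le_col j
  rw [Finset.sum_eq_zero fun i _ => (hA.zero_or_one i j).resolve_right (h i)] at this
  norm_num at this

theorem IsTransitionMatrix.exists_shift (hA : IsTransitionMatrix A) (i : Fin N) :
    ∃ s : Shift A, s.1 0 = i := by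
  choose g hg using hA.exists_row
  refine ⟨⟨fun k => g^[k] i, fun k => ?_⟩, rfl⟩
  have := hg (g^[k] i)
  rwa [← Function.iterate_succ_apply' g k i] at this

/-! ### Counting admissible words by powers of the matrix -/

/-- The admissible words with `n + 1` letters that start with `i`. -/
def words (A : Matrix (Fin N) (Fin N) ℝ) : ℕ → Fin N → Finset (List (Fin N))
  | 0, i => {[i]}
  | n + 1, i => open Classical in
    (Finset.univ.filter fun j => A i j = 1).biUnion fun j => (words A n j).image (i :: ·)

/-- No row vanishes, so the last letter of a word can always be continued forever. -/
theorem IsTransitionMatrix.exists_shift_of_mem_words (hA : IsTransitionMatrix A) {n : ℕ}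
    {i : Fin N} {l : List (Fin N)} (hl : l ∈ words A n i) :
    ∃ s : Shift A, s.1 0 = i ∧ (List.range (n + 1)).map s.1 = l := by
  induction n generalizing i l with
  | zero =>
    obtain ⟨s, hs⟩ := hA.exists_shift i
    rw [words, Finset.mem_singleton] at hl
    exact ⟨s, hs, by simp [hl, hs]⟩
  | succ n ih =>
    simp only [words, Finset.mem_biUnion, Finset.mem_filter, Finset.mem_univ, true_and,
      Finset.mem_image] at hl
    obtain ⟨j, hij, l', hl', rfl⟩ := hl
    obtain ⟨s, hs, rfl⟩ := ih hl'
    refine ⟨s.cons i (by rw [hs]; exact hij), rfl, ?_⟩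
    rw [List.range_succ_eq_map, List.map_cons, List.map_map]
    rfl

theorem head?_of_mem_words {n : ℕ} {i : Fin N} {l : List (Fin N)} (hl : l ∈ words A n i) :
    l.head? = some i := by
  cases n with
  | zero => rw [words, Finset.mem_singleton] at hl; simp [hl]
  | succ n =>
    simp only [words, Finset.mem_biUnion, Finset.mem_image] at hl
    obtain ⟨j, -, l', -, rfl⟩ := hl
    rfl

theorem words_disjoint (n : ℕ) {i j : Fin N} (hij : i ≠ j) :
    Disjoint (words A n i) (words A n j) :=
  Finset.disjoint_left.2 fun _ h1 h2 =>
    hij (Option.some.inj ((head?_of_mem_words h1).symm.trans (head?_of_mem_words h2)))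

/-- The recursion of `words` on the second letter is the expansion of `A ^ (n + 1)` as `A * A ^ n`;
the union over that letter is disjoint. -/
theorem IsTransitionMatrix.card_words (hA : IsTransitionMatrix A) (n : ℕ) (i : Fin N) :
    ((words A n i).card : ℝ) = ∑ j, (A ^ n) i j := by
  classical
  induction n generalizing i with
  | zero => simp [words, Matrix.one_apply]
  | succ n ih =>
    have hinj : Function.Injective (i :: · : List (Fin N) → List (Fin N)) :=
      List.cons_injective
    rw [words, Finset.card_biUnion]
    · push_cast
      simp only [Finset.card_image_of_injective _ hinj, ih, pow_succ', Matrix.mul_apply]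
      rw [Finset.sum_comm, Finset.sum_filter]
      refine Finset.sum_congr rfl fun j _ => ?_
      rw [← Finset.mul_sum]
      rcases hA.zero_or_one i j with h | h <;> simp [h]
    · intro j _ k _ hjk
      exact (Finset.disjoint_image hinj).2 (words_disjoint n hjk)

/-- The admissible words with `n + 1` letters. -/
def allWords (A : Matrix (Fin N) (Fin N) ℝ) (n : ℕ) : Finset (List (Fin N)) :=
  Finset.univ.biUnion (words A n)

theorem IsTransitionMatrix.card_allWords (hA : IsTransitionMatrix A) (n : ℕ) :
    ((allWords A n).card : ℝ) = entrySum (A ^ n) := by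
  rw [allWords, Finset.card_biUnion fun i _ j _ hij => words_disjoint n hij]
  push_cast
  exact Finset.sum_congr rfl fun i _ => hA.card_words n i

theorem IsTransitionMatrix.exists_shift_of_mem_allWords (hA : IsTransitionMatrix A) {n : ℕ}
    {l : List (Fin N)} (hl : l ∈ allWords A n) :
    ∃ s : Shift A, (List.range (n + 1)).map s.1 = l := by
  obtain ⟨i, -, hi⟩ := Finset.mem_biUnion.1 hl
  obtain ⟨s, -, hs⟩ := hA.exists_shift_of_mem_words hi
  exact ⟨s, hs⟩

/-- The denominator is `n + 1`, the number of letters of the words counted by `A ^ n`; the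
correction `n / (n + 1)` tends to `1`. -/
theorem IsTransitionMatrix.tendsto_log_entrySum (hA : IsTransitionMatrix A) :
    Tendsto (fun n : ℕ => Real.log (entrySum (A ^ n)) / ((n + 1 : ℕ) : ℝ)) atTop
      (𝓝 (Real.log (rho A))) := by
  have hρ : 1 ≤ rho A := ge_of_tendsto' (tendsto_rho hA) fun n =>
    Real.one_le_rpow (hA.one_le_entrySum_pow n) (by positivity)
  have h1 := ((tendsto_rho hA).log (by positivity)).mul (tendsto_natCast_div_add_atTop (1 : ℝ))
  rw [mul_one] at h1
  refine h1.congr' ?_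
  filter_upwards [eventually_gt_atTop 0] with n hn
  have hn' : (n : ℝ) ≠ 0 := by positivity
  rw [Real.log_rpow (lt_of_lt_of_le one_pos (hA.one_le_entrySum_pow n))]
  push_cast
  field_simp

end Shift

/-! ### Compact sets with a common itinerary -/

section Itinerary

variable {X : Type*} {N : ℕ} {A : Matrix (Fin N) (Fin N) ℝ} {f : ℕ → X → X}
  {V : Fin N → ℕ → Set X} {W : Fin N → Set X}

/-- All points of `B`, started at time `n`, follow the symbols of `α`; that is, `B` is contained
in the intersection of the cylinders `V_α^{m,n}`. -/
def Follows (f : ℕ → X → X) (V : Fin N → ℕ → Set X) (n : ℕ) (B : Set X) (α : Shift A) : Prop :=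
  ∀ k, ∀ x ∈ B, iter f n k x ∈ V (α.1 k) (n + k)

theorem Follows.image {n : ℕ} {B : Set X} {α : Shift A} (h : Follows f V n B α) :
    Follows f V (n + 1) (f n '' B) (shiftMap A α) := by
  rintro k _ ⟨x, hx, rfl⟩
  have := h (k + 1) x hx
  rw [iter_succ_apply', ← add_assoc, add_right_comm] at this
  exact this

theorem Follows.cons {n : ℕ} {B : Set X} {β : Shift A} (h : Follows f V (n + 1) (f n '' B) β)
    {i : Fin N} (hi : A i (β.1 0) = 1) (hB : B ⊆ V i n) : Follows f V n B (β.cons i hi) := by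
  intro k x hx
  cases k with
  | zero => exact hB hx
  | succ k =>
    have := h k (f n x) (mem_image_of_mem _ hx)
    rw [← iter_succ_apply', add_right_comm] at this
    exact this

theorem Follows.symbol_eq (hWdisj : ∀ i j, i ≠ j → Disjoint (W i) (W j))
    (hVW : ∀ i n, V i n ⊆ W i) {n : ℕ} {B : Set X} {α : Shift A} (h : Follows f V n B α)
    (hB : B.Nonempty) {k : ℕ} {i : Fin N} (hi : ∀ x ∈ B, iter f n k x ∈ W i) : α.1 k = i := by
  by_contra hne
  obtain ⟨x, hx⟩ := hB
  exact Set.disjoint_left.1 (hWdisj _ _ hne) (hVW _ _ (h k x hx)) (hi x hx)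

theorem Follows.unique (hWdisj : ∀ i j, i ≠ j → Disjoint (W i) (W j))
    (hVW : ∀ i n, V i n ⊆ W i) {n : ℕ} {B : Set X} {α β : Shift A} (h : Follows f V n B α)
    (h' : Follows f V n B β) (hB : B.Nonempty) : α = β :=
  Subtype.ext <| funext fun k => h.symbol_eq hWdisj hVW hB fun x hx => hVW _ _ (h' k x hx)

/-- The compact sets all of whose points share an itinerary in the subshift. -/
def itinerarySet [TopologicalSpace X] (A : Matrix (Fin N) (Fin N) ℝ) (f : ℕ → X → X)
    (V : Fin N → ℕ → Set X) (n : ℕ) : Set (NonemptyCompacts X) :=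
  {B | ∃ α : Shift A, Follows f V n B α}

theorem itinerarySet_subset [TopologicalSpace X] (n : ℕ) :
    itinerarySet A f V n ⊆ ⋃ i, compactsIn (V i n) := by
  rintro B ⟨α, hα⟩
  exact mem_iUnion.2 ⟨α.1 0, fun x hx => hα 0 x hx⟩

theorem mapsTo_induced_itinerarySet [TopologicalSpace X] (hf : ∀ n, Continuous (f n)) :
    IsInvariantSeq (induced f hf) (itinerarySet A f V) := by
  rintro n B ⟨α, hα⟩
  exact ⟨shiftMap A α, hα.image⟩

theorem exists_mem_follows [TopologicalSpace X] [CompactSpace X] (hf : ∀ n, Continuous (f n))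
    (hVcl : ∀ i n, IsClosed (V i n))
    (h : ∀ (m n : ℕ) (α : Shift A), (cylinder f V α m n).Nonempty) (n : ℕ) (α : Shift A) :
    ∃ B : NonemptyCompacts X, Follows f V n B α := by
  have hcl : ∀ m, IsClosed (cylinder f V α m n) := fun m =>
    isClosed_biInter fun k _ => (hVcl _ _).preimage (continuous_iter hf n k)
  have hne : (⋂ m, cylinder f V α m n).Nonempty :=
    IsCompact.nonempty_iInter_of_sequence_nonempty_isCompact_isClosed _
      (fun m => biInter_subset_biInter_left fun k hk => by
        simp only [SetLike.mem_coe, Finset.mem_range] at hk ⊢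
        omega)
      (fun m => h m n α) (hcl 0).isCompact hcl
  refine ⟨⟨⟨_, (isClosed_iInter hcl).isCompact⟩, hne⟩, fun k x hx => ?_⟩
  exact mem_iInter₂.1 (mem_iInter.1 hx k) k (Finset.mem_range.2 k.lt_succ_self)

/-- A union over all `α` need not be closed, so the condition is localized: at each time some
allowed pair of consecutive symbols is followed. This is an intersection of finite unions of closed
sets, and the pairs glue to one sequence because the `W i` are disjoint. -/
theorem isClosed_itinerarySet [MetricSpace X] (hf : ∀ n, Continuous (f n))
    (hVcl : ∀ i n, IsClosed (V i n)) (hWdisj : ∀ i j, i ≠ j → Disjoint (W i) (W j))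
    (hVW : ∀ i n, V i n ⊆ W i) (n : ℕ) : IsClosed (itinerarySet A f V n) := by
  have heq : itinerarySet A f V n = ⋂ k, ⋃ p ∈ {p : Fin N × Fin N | A p.1 p.2 = 1},
      {B : NonemptyCompacts X | (B : Set X) ⊆ iter f n k ⁻¹' V p.1 (n + k) ∩
        iter f n (k + 1) ⁻¹' V p.2 (n + (k + 1))} := by
    ext B
    simp only [mem_iInter, mem_iUnion₂]
    constructor
    · rintro ⟨α, hα⟩ k
      exact ⟨(α.1 k, α.1 (k + 1)), α.2 k, fun x hx => ⟨hα k x hx, hα (k + 1) x hx⟩⟩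
    · intro h
      choose p hp hB using h
      have hstep : ∀ k, (p k).2 = (p (k + 1)).1 := fun k => by
        obtain ⟨x, hx⟩ := B.nonempty
        by_contra hne
        exact Set.disjoint_left.1 (hWdisj _ _ hne) (hVW _ _ (hB k hx).2)
          (hVW _ _ (hB (k + 1) hx).1)
      exact ⟨⟨fun k => (p k).1, fun k => (congrArg (A (p k).1) (hstep k)).symm.trans (hp k)⟩,
        fun k x hx => (hB k hx).1⟩
  rw [heq]
  refine isClosed_iInter fun k => (Set.toFinite _).isClosed_biUnion fun p _ => ?_
  exact NonemptyCompacts.isClosed_subsets_of_isClosed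
    (((hVcl _ _).preimage (continuous_iter hf n k)).inter
      ((hVcl _ _).preimage (continuous_iter hf n (k + 1))))

theorem isEquiSemiconjugate_itinerarySet [MetricSpace X] [CompactSpace X]
    (hf : ∀ n, Continuous (f n))
    (hequi : EquiContinuousSeq (α := fun _ => X) (β := fun _ => X) f)
    (hVcl : ∀ i n, IsClosed (V i n)) (hWcl : ∀ i, IsClosed (W i))
    (hWdisj : ∀ i j, i ≠ j → Disjoint (W i) (W j)) (hVW : ∀ i n, V i n ⊆ W i)
    (h : ∀ (m n : ℕ) (α : Shift A), (cylinder f V α m n).Nonempty) :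
    IsEquiSemiconjugate (induced f hf) (itinerarySet A f V) (fun _ => shiftMap A)
      (fun _ => univ) := by
  choose g hg using fun (n : ℕ) (B : itinerarySet A f V n) => B.2
  refine ⟨mapsTo_induced_itinerarySet hf, fun _ => mapsTo_univ _ _,
    fun n B => ⟨g n B, mem_univ _⟩, ?_, ?_, ?_⟩
  · intro ε hε
    obtain ⟨η, hη, hsep⟩ := exists_pos_forall_le_dist hWcl hWdisj
    obtain ⟨m, hm⟩ := exists_pow_lt_of_lt_one (half_pos hε) (by norm_num : (1 / 2 : ℝ) < 1)
    obtain ⟨δ, hδ, H⟩ := hequi.exists_iter m hη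
    refine ⟨δ, hδ, fun n B B' hBB' => ?_⟩
    change dist (g n B) (g n B') < ε
    refine (Shift.dist_le_of_agree (m := m) fun k hk => ?_).trans_lt (by linarith)
    -- One point of each set suffices, since all points of a set share its itinerary.
    obtain ⟨x, hx⟩ := B.1.nonempty
    obtain ⟨y, hy, hxy⟩ := exists_dist_lt_of_mem hBB' hx
    exact hsep _ _ _ (hVW _ _ (hg n B k x hx)) _ (hVW _ _ (hg n B' k y hy)) (H n x y hxy k hk.le)
  · rintro n ⟨α, -⟩
    obtain ⟨B, hB⟩ := exists_mem_follows hf hVcl h n α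
    exact ⟨⟨B, α, hB⟩, Subtype.ext ((hg n ⟨B, α, hB⟩).unique hWdisj hVW hB B.nonempty)⟩
  · intro n
    funext B
    refine Subtype.ext ?_
    exact (hg (n + 1) _).unique hWdisj hVW (hg n B).image (B.1.nonempty.image _)

/-! ### Entropy -/

/-- Each word picks a compact set following it and a member of the subcover containing that set.
This choice is injective: two sets in one member have their `k`-th images in a common `U k`, which
forces equal `k`-th letters. -/
theorem card_allWords_le_minSubcover [MetricSpace X] [CompactSpace X]
    (hA : IsTransitionMatrix A) (hf : ∀ n, Continuous (f n)) (hVcl : ∀ i n, IsClosed (V i n))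
    (hVW : ∀ i n, V i n ⊆ W i)
    (h : ∀ (m n : ℕ) (α : Shift A), (cylinder f V α m n).Nonempty)
    {𝒜 : Set (Set (NonemptyCompacts X))}
    (h𝒜 : ∀ U ∈ 𝒜, ∀ B ∈ U, ∀ B' ∈ U, ∀ i j, (B : Set X) ⊆ W i → (B' : Set X) ⊆ W j → i = j)
    (n : ℕ) :
    ((allWords A n).card : ℕ∞) ≤ minSubcover (restrictCover (joinCover (induced f hf) 𝒜 (n + 1))
      (itinerarySet A f V 0)) (itinerarySet A f V 0) := by
  refine le_iInf₂ fun ℬ hℬ => le_iInf fun hcov => ?_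
  have hex : ∀ l ∈ allWords A n, ∃ (s : Shift A) (B : NonemptyCompacts X) (S : _),
      (List.range (n + 1)).map s.1 = l ∧ Follows f V 0 B s ∧ B ∈ S ∧ S ∈ ℬ := by
    intro l hl
    obtain ⟨s, hs⟩ := hA.exists_shift_of_mem_allWords hl
    obtain ⟨B, hB⟩ := exists_mem_follows hf hVcl h 0 s
    obtain ⟨S, hS, hBS⟩ := hcov ⟨s, hB⟩
    exact ⟨s, B, S, hs, hB, hBS, hS⟩
  choose! s B S hs hB hBS hS using hex
  rw [← Set.encard_coe_eq_coe_finsetCard]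
  refine encard_le_encard_of_injOn (f := S) (fun l hl => hS l hl) fun l hl l' hl' hll' => ?_
  rw [← hs l hl, ← hs l' hl']
  refine List.map_congr_left fun k hk => ?_
  obtain ⟨_, ⟨U, hU, rfl⟩, hUS⟩ := hℬ (hS l hl)
  have hk' := List.mem_range.1 hk
  have h1 := hBS l hl
  have h2 := hBS l' hl'
  rw [← hll', ← hUS] at h2
  rw [← hUS] at h1
  refine h𝒜 _ (hU ⟨k, hk'⟩) _ (mem_iInter.1 h1.1 ⟨k, hk'⟩) _ (mem_iInter.1 h2.1 ⟨k, hk'⟩) _ _ ?_ ?_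
  · rw [coe_iter_induced hf, image_subset_iff]
    intro x hx
    exact hVW _ _ (hB l hl k x hx)
  · rw [coe_iter_induced hf, image_subset_iff]
    intro x hx
    exact hVW _ _ (hB l' hl' k x hx)

theorem exists_open_cover_separating [MetricSpace X] [CompactSpace X]
    (hWcl : ∀ i, IsClosed (W i)) (hWdisj : ∀ i j, i ≠ j → Disjoint (W i) (W j)) :
    ∃ 𝒜 : Set (Set (NonemptyCompacts X)), (∀ U ∈ 𝒜, IsOpen U) ∧ ⋃₀ 𝒜 = univ ∧
      ∀ U ∈ 𝒜, ∀ B ∈ U, ∀ B' ∈ U, ∀ i j, (B : Set X) ⊆ W i → (B' : Set X) ⊆ W j → i = j := by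
  obtain ⟨η, hη, hsep⟩ := exists_pos_forall_le_dist hWcl hWdisj
  refine ⟨range fun B => Metric.ball B (η / 2), ?_, ?_, ?_⟩
  · rintro _ ⟨B, rfl⟩
    exact Metric.isOpen_ball
  · exact eq_univ_of_forall fun B => ⟨_, ⟨B, rfl⟩, Metric.mem_ball_self (half_pos hη)⟩
  · rintro _ ⟨D, rfl⟩ B hB B' hB' i j hi hj
    have hBB' : dist B B' < η := by
      have := dist_triangle_right B B' D
      rw [Metric.mem_ball] at hB hB'
      linarith
    obtain ⟨x, hx⟩ := B.nonempty
    obtain ⟨y, hy, hxy⟩ := exists_dist_lt_of_mem hBB' hx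
    exact hsep i j x (hi hx) y (hj hy) hxy

theorem log_rho_le_entropy_itinerarySet [MetricSpace X] [CompactSpace X]
    (hA : IsTransitionMatrix A) (hf : ∀ n, Continuous (f n)) (hVcl : ∀ i n, IsClosed (V i n))
    (hWcl : ∀ i, IsClosed (W i)) (hWdisj : ∀ i j, i ≠ j → Disjoint (W i) (W j))
    (hVW : ∀ i n, V i n ⊆ W i)
    (h : ∀ (m n : ℕ) (α : Shift A), (cylinder f V α m n).Nonempty) :
    ((Real.log (rho A) : ℝ) : EReal) ≤ entropy (induced f hf) (itinerarySet A f V 0) := by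
  obtain ⟨𝒜, hopen, hcov, hsep⟩ := exists_open_cover_separating hWcl hWdisj
  refine le_trans ?_ (le_iSup₂_of_le 𝒜 hopen (le_iSup_of_le hcov le_rfl))
  have hlim : Tendsto (fun n : ℕ =>
      ((Real.log (entrySum (A ^ n)) / ((n + 1 : ℕ) : ℝ) : ℝ) : EReal)) atTop
      (𝓝 ((Real.log (rho A) : ℝ) : EReal)) :=
    EReal.tendsto_coe.2 hA.tendsto_log_entrySum
  rw [← hlim.limsup_eq]
  -- The shift of the index by one matches `A ^ n` with the join of `n + 1` covers.
  refine le_trans (limsup_le_limsup (Eventually.of_forall fun n => ?_)) (limsup_nat_add _ 1).le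
  have hcard := card_allWords_le_minSubcover hA hf hVcl hVW h hsep n
  have hpos : 0 < entrySum (A ^ n) := lt_of_lt_of_le one_pos (hA.one_le_entrySum_pow n)
  simp only
  rw [EReal.coe_div, EReal.coe_coe_eq_natCast]
  refine EReal.div_le_div_right_of_nonneg (Nat.cast_nonneg' _) ?_
  rw [← ENNReal.log_ofReal_of_pos hpos, ← hA.card_allWords n, ENNReal.ofReal_natCast]
  refine ENNReal.log_le_log ?_
  exact_mod_cast ENat.toENNReal_le.2 hcard

/-! ### Weak coupled-expansion -/

/-- A point of the cylinder of the shifted sequence at time `n + 1` lies in `V (α.1 1) (n + 1)`, so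
it has a preimage in `V (α.1 0) n`. -/
theorem IsWeaklyCoupledExpanding.cylinder_nonempty [TopologicalSpace X]
    (h : IsWeaklyCoupledExpanding A f V) (m n : ℕ) (α : Shift A) :
    (cylinder f V α m n).Nonempty := by
  induction m generalizing n α with
  | zero =>
    obtain ⟨x, hx⟩ := h.nonempty (α.1 0) n
    refine ⟨x, mem_iInter₂.2 fun k hk => ?_⟩
    obtain rfl : k = 0 := by simpa using hk
    exact hx
  | succ m ih =>
    obtain ⟨y, hy⟩ := ih (n + 1) (shiftMap A α)
    have hy' := mem_iInter₂.1 hy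
    have hy0 : y ∈ V (α.1 1) (n + 1) := hy' 0 (Finset.mem_range.2 m.succ_pos)
    obtain ⟨x, hx, rfl⟩ := h.expanding (α.1 0) n (mem_iUnion₂.2 ⟨α.1 1, α.2 0, hy0⟩)
    refine ⟨x, mem_iInter₂.2 fun k hk => ?_⟩
    cases k with
    | zero => exact hx
    | succ k =>
      have := hy' k (Finset.mem_range.2 (by have := Finset.mem_range.1 hk; omega))
      rw [mem_preimage, ← iter_succ_apply', add_right_comm] at this
      exact this

/-- A nonzero column supplies a symbol `i` that may precede `β`. Then `f n` maps `V i n` over `B`,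
so `V i n ∩ f n ⁻¹' B` is compact, has image exactly `B`, and follows `β` with `i` prefixed. -/
theorem IsWeaklyCoupledExpanding.image_itinerarySet [TopologicalSpace X] [CompactSpace X]
    [T2Space X] (h : IsWeaklyCoupledExpanding A f V) (hf : ∀ n, Continuous (f n))
    (hVcl : ∀ i n, IsClosed (V i n)) (n : ℕ) :
    induced f hf n '' itinerarySet A f V n = itinerarySet A f V (n + 1) := by
  refine (mapsTo_induced_itinerarySet hf n).image_subset.antisymm ?_
  rintro B ⟨β, hβ⟩
  obtain ⟨i, hi⟩ := h.transition.exists_col (β.1 0)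
  have hB : (B : Set X) ⊆ f n '' V i n := fun x hx =>
    h.expanding i n (mem_iUnion₂.2 ⟨β.1 0, hi, hβ 0 x hx⟩)
  have himage : f n '' (V i n ∩ f n ⁻¹' B) = B := by
    rw [image_inter_preimage, inter_eq_right.2 hB]
  have hcpt : IsCompact (V i n ∩ f n ⁻¹' B) :=
    ((hVcl i n).inter (B.isCompact.isClosed.preimage (hf n))).isCompact
  have hne : (V i n ∩ f n ⁻¹' B).Nonempty := by
    rw [← image_nonempty (f := f n), himage]
    exact B.nonempty
  refine ⟨⟨⟨_, hcpt⟩, hne⟩, ⟨β.cons i hi, Follows.cons ?_ hi inter_subset_left⟩,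
    NonemptyCompacts.ext himage⟩
  exact himage.symm ▸ hβ

end Itinerary

end SetValuedSubshift

end

/-! ### Both cases, with the itinerary sets as witnesses -/

theorem theorem4p4 {X : Type*} [MetricSpace X] [CompactSpace X] {N : ℕ}
    (A : Matrix (Fin N) (Fin N) ℝ) (hA : SetValuedSubshift.IsTransitionMatrix A)
    (f : ℕ → X → X) (hf : ∀ n, Continuous (f n))
    (hequi : SetValuedSubshift.EquiContinuousSeq (α := fun _ => X) (β := fun _ => X) f)
    (V : Fin N → ℕ → Set X) (hVne : ∀ i n, (V i n).Nonempty) (hVcl : ∀ i n, IsClosed (V i n))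
    (W : Fin N → Set X) (hWcl : ∀ i, IsClosed (W i))
    (hWdisj : ∀ i j, i ≠ j → Disjoint (W i) (W j)) (hVW : ∀ i n, V i n ⊆ W i) :
    ((∀ (m n : ℕ) (α : SetValuedSubshift.Shift A),
        (SetValuedSubshift.cylinder f V α m n).Nonempty) →
      ∃ C : ℕ → Set (TopologicalSpace.NonemptyCompacts X),
        (∀ n, (C n).Nonempty ∧ IsCompact (C n) ∧
          C n ⊆ (⋃ i, SetValuedSubshift.compactsIn (V i n)) ∧
          SetValuedSubshift.induced f hf n '' C n ⊆ C (n + 1)) ∧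
        SetValuedSubshift.IsEquiSemiconjugate (SetValuedSubshift.induced f hf) C
          (fun _ => SetValuedSubshift.shiftMap A) (fun _ => Set.univ) ∧
        ((Real.log (SetValuedSubshift.rho A) : ℝ) : EReal) ≤
          SetValuedSubshift.entropy (SetValuedSubshift.induced f hf) (C 0)) ∧
    (SetValuedSubshift.IsWeaklyCoupledExpanding A f V →
      ∃ C : ℕ → Set (TopologicalSpace.NonemptyCompacts X),
        (∀ n, (C n).Nonempty ∧ IsCompact (C n) ∧
          C n ⊆ (⋃ i, SetValuedSubshift.compactsIn (V i n)) ∧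
          SetValuedSubshift.induced f hf n '' C n = C (n + 1)) ∧
        SetValuedSubshift.IsEquiSemiconjugate (SetValuedSubshift.induced f hf) C
          (fun _ => SetValuedSubshift.shiftMap A) (fun _ => Set.univ) ∧
        ((Real.log (SetValuedSubshift.rho A) : ℝ) : EReal) ≤
          SetValuedSubshift.entropy (SetValuedSubshift.induced f hf) (C 0)) := by
  have hN := hA.two_le
  have key : (∀ (m n : ℕ) (α : SetValuedSubshift.Shift A),
      (SetValuedSubshift.cylinder f V α m n).Nonempty) →
      ∀ n, (SetValuedSubshift.itinerarySet A f V n).Nonempty ∧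
        IsCompact (SetValuedSubshift.itinerarySet A f V n) := fun h n => by
    obtain ⟨α, -⟩ := hA.exists_shift ⟨0, by omega⟩
    obtain ⟨B, hB⟩ := SetValuedSubshift.exists_mem_follows hf hVcl h n α
    exact ⟨⟨B, α, hB⟩,
      (SetValuedSubshift.isClosed_itinerarySet hf hVcl hWdisj hVW n).isCompact⟩
  refine ⟨fun h => ?_, fun hexp => ?_⟩
  · exact ⟨SetValuedSubshift.itinerarySet A f V,
      fun n => ⟨(key h n).1, (key h n).2, SetValuedSubshift.itinerarySet_subset n,
        (SetValuedSubshift.mapsTo_induced_itinerarySet hf n).image_subset⟩,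
      SetValuedSubshift.isEquiSemiconjugate_itinerarySet hf hequi hVcl hWcl hWdisj hVW h,
      SetValuedSubshift.log_rho_le_entropy_itinerarySet hA hf hVcl hWcl hWdisj hVW h⟩
  · have h := fun m n => hexp.cylinder_nonempty m n
    exact ⟨SetValuedSubshift.itinerarySet A f V,
      fun n => ⟨(key h n).1, (key h n).2, SetValuedSubshift.itinerarySet_subset n,
        hexp.image_itinerarySet hf hVcl n⟩,
      SetValuedSubshift.isEquiSemiconjugate_itinerarySet hf hequi hVcl hWcl hWdisj hVW h,
      SetValuedSubshift.log_rho_le_entropy_itinerarySet hA hf hVcl hWcl hWdisj hVW h⟩
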